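/- For an integer $N\ge 1$ define $\theta_0=1$, $\theta_i=\tfrac12\bigl(1+\sqrt{1+4\theta_{i-1}^2}\bigr)$ for $1\le i\le N-1$, and $\theta_N=\tfrac12\bigl(1+\sqrt{1+8\theta_{N-1}^2}\bigr)$. For $L>0$, a function $f\colon\mathbb{R}^d\to\mathbb{R}$ is called $L$-smooth and convex if it is differentiable and $f(y)\ge f(x)+\langle\nabla f(x),y-x\rangle+\tfrac{1}{2L}\|\nabla f(x)-\nabla f(y)\|^2$ for all $x,y\in\mathbb{R}^d$ (equivalently, $f$ is convex with $L$-Lipschitz gradient). For a closed convex proper $h\colon\mathbb{R}^d\to\mathbb{R}\cup\{\infty\}$ and $\gamma>0$ let $\mathbf{prox}_{\gamma h}(x)=\operatorname{argmin}_{z}\{h(z)+\tfrac{1}{2\gamma}\|z-x\|^2\}$. Fix a starting point $x_0\in\mathbb{R}^d$. A method assigns to each pair $(f,h)$ an output $x_N\in\mathbb{R}^d$. It satisfies the double-function span condition if, for every $L$-smooth convex $f$ and every closed convex proper $h$ such that $f+h$ has a minimizer, there are $\delta_i\in\{0,1\}$ and $z_i,d_i\in\mathbb{R}^d$ ($0\le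 i\le 2N-1$) with $z_0=x_0$ such that $$\sum_{i=0}^{2N-1}\delta_i=\sum_{i=0}^{2N-1}(1-\delta_i)=N,\qquad d_i=\begin{cases}\nabla f(z_i)&\text{if }\delta_i=0,\\ z_i-\mathbf{prox}_{\gamma_i h}(z_i)\ \text{for some }\gamma_i>0&\text{if }\delta_i=1,\end{cases}\qquad 0\le i\le 2N-1,$$ $$z_i\in x_0+\operatorname{span}\{d_0,\dots,d_{i-1}\}\ \ (1\le i\le 2N-1),\qquad x_N\in x_0+\operatorname{span}\{d_0,\dots,d_{2N-1}\}.$$ **Theorem.** Let $L>0$, $R>0$, $N\ge 1$, $d\ge N+1$ and $x_0\in\mathbb{R}^d$. For every method satisfying the double-function span condition there are an $L$-smooth convex function $f\colon\mathbb{R}^d\to\mathbb{R}$, an indicator function $h\colon\mathbb{R}^d\to\mathbb{R}\cup\{\infty\}$ of a nonempty closed convex set ($0$ on the set and $\infty$ off it), and an $x_\star\in\operatorname{argmin}(f+h)$ with $\|x_0-x_\star\|=R$ such that the output $x_N$ of the method on $(f,h)$ satisfies $$f(x_N)+h(x_N)-f(x_\star)-h(x_\star)\ \ge\ \frac{L\|x_0-x_\star\|^2}{2(\theta_N^2-1)}.$$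 -/

import Mathlib

open scoped BigOperators

noncomputable section

namespace CompositeOpt

/-- Euclidean space `ℝ^d` with its standard inner product and norm. -/
abbrev Euc (d : ℕ) : Type := EuclideanSpace ℝ (Fin d)

/-- The coefficients `θ_i` for total iteration count `N`: `θ_0 = 1`,
`θ_i = (1 + √(1 + 4 θ_{i-1}²)) / 2` for `1 ≤ i ≤ N - 1`, and
`θ_N = (1 + √(1 + 8 θ_{N-1}²)) / 2`. (The values at `i > N` are irrelevant.) -/
def theta (N : ℕ) : ℕ → ℝ
  | 0 => 1
  | i + 1 =>
      if i + 1 = N then (1 + Real.sqrt (1 + 8 * theta N i ^ 2)) / 2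
      else (1 + Real.sqrt (1 + 4 * theta N i ^ 2)) / 2

/-- `f` is `L`-smooth and convex (`L > 0`): it is differentiable and
`f y ≥ f x + ⟪∇f x, y - x⟫ + ‖∇f x - ∇f y‖² / (2L)` for all `x, y`. -/
def LSmoothConvex {d : ℕ} (L : ℝ) (f : Euc d → ℝ) : Prop :=
  Differentiable ℝ f ∧
    ∀ x y : Euc d,
      f x + inner ℝ (gradient f x) (y - x)
        + 1 / (2 * L) * ‖gradient f x - gradient f y‖ ^ 2 ≤ f y

/-- `h : ℝ^d → ℝ ∪ {∞}` is closed, convex and proper. -/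
def ClosedConvexProper {d : ℕ} (h : Euc d → EReal) : Prop :=
  (∀ x, h x ≠ ⊥) ∧ (∃ x, h x ≠ ⊤) ∧ LowerSemicontinuous h ∧
    ∀ x y : Euc d, ∀ t : ℝ, 0 < t → t < 1 →
      h (t • x + (1 - t) • y) ≤ (t : EReal) * h x + ((1 - t : ℝ) : EReal) * h y

open Classical in
/-- The convex-analytic indicator of a set: `0` on `C` and `∞` off `C`. -/
def indicatorFn {d : ℕ} (C : Set (Euc d)) : Euc d → EReal :=
  fun x => if x ∈ C then 0 else ⊤

/-- `x` belongs to `argmin (f + h)`. -/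
def IsMinimizer {d : ℕ} (f : Euc d → ℝ) (h : Euc d → EReal) (x : Euc d) : Prop :=
  ∀ y, (f x : EReal) + h x ≤ (f y : EReal) + h y

/-- `p` is `prox_{γ h}(x)`, the minimizer of `z ↦ h z + ‖z - x‖² / (2γ)`
(it exists and is unique when `h` is closed, convex, proper and `γ > 0`). -/
def IsProx {d : ℕ} (γ : ℝ) (h : Euc d → EReal) (x p : Euc d) : Prop :=
  ∀ z, h p + ((1 / (2 * γ) * ‖p - x‖ ^ 2 : ℝ) : EReal)
    ≤ h z + ((1 / (2 * γ) * ‖z - x‖ ^ 2 : ℝ) : EReal)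

/-- The double-function span condition for an output `xN` on the pair `(f, h)`, started at `x₀`.
There are oracle choices `δ_i`, query points `z_i` and directions `v_i`, `i = 0, …, 2N - 1`,
with exactly `N` gradient and `N` proximal evaluations in some order; every query point lies in
`x₀` plus the span of the earlier directions (for `i = 0` this says `z_0 = x₀`), and `xN` lies in
`x₀` plus the span of all directions. -/
def SpanCondition {d : ℕ} (N : ℕ) (x₀ : Euc d) (f : Euc d → ℝ) (h : Euc d → EReal)
    (xN : Euc d) : Prop :=
  ∃ (δ : Fin (2 * N) → ℤ) (z v : Fin (2 * N) → Euc d),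
    (∀ i, δ i = 0 ∨ δ i = 1) ∧
    ∑ i, δ i = (N : ℤ) ∧ ∑ i, (1 - δ i) = (N : ℤ) ∧
    (∀ i, δ i = 0 → v i = gradient f (z i)) ∧
    (∀ i, δ i = 1 → ∃ γ : ℝ, 0 < γ ∧ ∃ p, IsProx γ h (z i) p ∧ v i = z i - p) ∧
    (∀ i, z i - x₀ ∈ Submodule.span ℝ (v '' {j | j < i})) ∧
    xN - x₀ ∈ Submodule.span ℝ (Set.range v)

/-- A method started at `x₀`, seen as the map sending a pair `(f, h)` to the output `x_N`, satisfies
the double-function span condition: it does so on every composite problem with `f` `L`-smooth convex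
and `h` closed, convex, proper for which a minimizer of `f + h` exists. -/
def MethodSatisfiesSpan {d : ℕ} (L : ℝ) (N : ℕ) (x₀ : Euc d)
    (M : (Euc d → ℝ) → (Euc d → EReal) → Euc d) : Prop :=
  ∀ (f : Euc d → ℝ) (h : Euc d → EReal), LSmoothConvex L f → ClosedConvexProper h →
    (∃ x, IsMinimizer f h x) → SpanCondition N x₀ f h (M f h)

end CompositeOpt

end

/-!
One fixed problem defeats every method. Take `x₀` as origin, and for a convex set `K` consider
`φ(u) = max_{w ∈ K} (⟪u, w⟫ - ‖w‖² / 2)`. The maximizer is the projection of `u` onto `K`, so `φ`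
is convex and `1`-smooth with gradient that projection (`inner_sub_half_norm_sq_le`,
`hasGradientAt_of_quadratic_lower_bound`). Let `K` be the simplex with vertices `c_i e_i`,
`0 ≤ i ≤ N`, let `u₀ = ∑ (b_i / c_i) e_i`, and put `f(x) = L φ(x - x₀ + u₀)`.

If `b_i - c_i² ≥ b_j` for `i < j`, a gradient at a point of `x₀ + span {e_j | j < k}` lies in
`span {e_j | j ≤ k}` (`projection_mem_leadingCoords`). The proximal map of the indicator of an
orthant `{x | ∀ i, x_i ≥ a_i}` containing `x₀` acts coordinatewise and reveals no coordinate
(`sub_prox_mem_leadingCoords`). So after `N` gradient and `N` proximal evaluations, in any order,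
the coordinate `N` of the output is still that of `x₀` (`SpanCondition.sub_mem`), and testing the
maximum at the vertex `c_N e_N` gives `f(x_N) ≥ L (b_N - c_N² / 2)`.

The coefficients come from the worst-case function of unconstrained smooth minimization, with
`b_i = 2 θ_i c_i²` for `i < N`, `b_N = θ_N c_N²` and `b_{i+1} = b_i - c_i²`. They satisfy
`∑ b_i / c_i² = θ_N²` and `b_N - c_N² / 2 = ‖u₀‖² / (2 θ_N²)` (`exists_chain_coefficients`). By
the first identity `p = u₀ / θ_N²` lies in `K`, hence `f` takes the value `L ‖p‖² / 2` at
`x⋆ = x₀ - u₀ + p`. Since `p ≥ 0`, testing the maximum at `p` shows that `x⋆` minimizes `f` over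
the orthant `x ≥ x⋆`, which contains `x₀`; without the constraint `f` is unbounded below. Taking
the convex hull of `K` and `0` in place of `K` would instead give an unconstrained problem
minimized at `x₀ - u₀`, with gap `‖u₀‖² / (2 θ_N²)` for `L = 1`. Ending at `x₀ - u₀ + p` shortens
the distance to `‖x₀ - x⋆‖ = (1 - θ_N⁻²) ‖u₀‖` and lowers the gap to
`‖u₀‖² / (2 θ_N²) - ‖u₀‖² / (2 θ_N⁴) = ‖x₀ - x⋆‖² / (2 (θ_N² - 1))`, which is the better ratio.
-/

namespace CompositeOpt

/-! ### Projections and the function they generate -/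

section Envelope

variable {E : Type*} [NormedAddCommGroup E] [InnerProductSpace ℝ E]

theorem exists_metric_projection [CompleteSpace E] {K : Set E} (hne : K.Nonempty)
    (hcl : IsClosed K) (hconv : Convex ℝ K) :
    ∃ P : E → E, ∀ u, P u ∈ K ∧ ∀ w ∈ K, inner ℝ (u - P u) (w - P u) ≤ 0 := by
  have h : ∀ u : E, ∃ p, p ∈ K ∧ ∀ w ∈ K, inner ℝ (u - p) (w - p) ≤ 0 := by
    intro u
    obtain ⟨p, hp, hmin⟩ := exists_norm_eq_iInf_of_complete_convex hne hcl.isComplete hconv u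
    exact ⟨p, hp, (norm_eq_iInf_iff_real_inner_le_zero hconv hp).1 hmin⟩
  choose P hP using h
  exact ⟨P, hP⟩

/-- If `P` is the metric projection onto `K`, then `P u` maximizes `w ↦ ⟪u, w⟫ - ‖w‖² / 2` over `K`,
with a quadratic margin. Applied to `w = P v`, the margin is exactly the cocoercivity term in the
definition of a `1`-smooth convex function with gradient `P`. -/
theorem inner_sub_half_norm_sq_le {K : Set E} {P : E → E}
    (hP : ∀ u, P u ∈ K ∧ ∀ w ∈ K, inner ℝ (u - P u) (w - P u) ≤ 0) (u : E) {w : E} (hw : w ∈ K) :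
    inner ℝ u w - 1 / 2 * ‖w‖ ^ 2 + 1 / 2 * ‖P u - w‖ ^ 2
      ≤ inner ℝ u (P u) - 1 / 2 * ‖P u‖ ^ 2 := by
  have h := (hP u).2 w hw
  simp only [inner_sub_left, inner_sub_right, real_inner_self_eq_norm_sq] at h
  have h2 := norm_sub_sq_real (P u) w
  linarith

/-- The smooth interpolation inequality alone makes `g` the gradient of `f`: used in both directions
it traps the linearization error between `0` and `L / 2 * ‖y - x‖ ^ 2`. -/
theorem hasGradientAt_of_quadratic_lower_bound [CompleteSpace E] {L : ℝ} (hL : 0 < L)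
    {f : E → ℝ} {g : E → E}
    (h : ∀ x y, f x + inner ℝ (g x) (y - x) + 1 / (2 * L) * ‖g x - g y‖ ^ 2 ≤ f y) (x : E) :
    HasGradientAt f (g x) x := by
  rw [hasGradientAt_iff_isLittleO]
  refine Asymptotics.IsBigO.trans_isLittleO (.of_bound (L / 2) (.of_forall fun y => ?_))
    (Asymptotics.isLittleO_pow_sub_sub x one_lt_two)
  have hxy := h x y
  have hyx := h y x
  have hpos : 0 ≤ 1 / (2 * L) * ‖g x - g y‖ ^ 2 := by positivity
  -- Young's inequality for `⟪g y - g x, y - x⟫`, written as the nonnegativity of a square.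
  have hsq : 0 ≤ 1 / (2 * L) * ‖(g y - g x) - L • (y - x)‖ ^ 2 := by positivity
  rw [norm_sub_sq_real, norm_smul, inner_smul_right, inner_sub_left, Real.norm_eq_abs, mul_pow,
    sq_abs, norm_sub_rev (g y)] at hsq
  have hexp : 1 / (2 * L) * (‖g x - g y‖ ^ 2 - 2 * (L * (inner ℝ (g y) (y - x)
      - inner ℝ (g x) (y - x))) + L ^ 2 * ‖y - x‖ ^ 2)
      = 1 / (2 * L) * ‖g x - g y‖ ^ 2 - (inner ℝ (g y) (y - x) - inner ℝ (g x) (y - x))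
        + L / 2 * ‖y - x‖ ^ 2 := by
    field_simp
  have hneg : inner ℝ (g y) (x - y) = - inner ℝ (g y) (y - x) := by
    rw [← inner_neg_right, neg_sub]
  rw [hneg, norm_sub_rev (g y)] at hyx
  rw [hexp] at hsq
  rw [norm_pow, norm_norm, Real.norm_eq_abs, abs_of_nonneg (by linarith)]
  linarith

end Envelope

/-! ### The sequence `theta` and the coefficients of the hard instance -/

section Theta

variable {N : ℕ}

theorem one_le_theta (N i : ℕ) : 1 ≤ theta N i := by
  cases i with
  | zero => simp [theta]
  | succ i =>
    rw [theta]
    split_ifs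
    · have : 1 ≤ √(1 + 8 * theta N i ^ 2) :=
        Real.one_le_sqrt.2 (le_add_of_nonneg_right (by positivity))
      linarith
    · have : 1 ≤ √(1 + 4 * theta N i ^ 2) :=
        Real.one_le_sqrt.2 (le_add_of_nonneg_right (by positivity))
      linarith

theorem theta_succ_sq_of_lt {i : ℕ} (hi : i + 1 < N) :
    theta N (i + 1) ^ 2 = theta N (i + 1) + theta N i ^ 2 := by
  rw [theta, if_neg hi.ne]
  have := Real.sq_sqrt (show 0 ≤ 1 + 4 * theta N i ^ 2 by positivity)
  linarith

theorem theta_last_sq {n : ℕ} :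
    theta (n + 1) (n + 1) ^ 2 = theta (n + 1) (n + 1) + 2 * theta (n + 1) n ^ 2 := by
  rw [theta, if_pos rfl]
  have := Real.sq_sqrt (show 0 ≤ 1 + 8 * theta (n + 1) n ^ 2 by positivity)
  linarith

theorem one_lt_theta_last (hN : 0 < N) : 1 < theta N N := by
  obtain ⟨n, rfl⟩ := Nat.exists_eq_succ_of_ne_zero hN.ne'
  have h1 := one_le_theta (n + 1) n
  have h2 := one_le_theta (n + 1) (n + 1)
  have h3 := theta_last_sq (n := n)
  simp only [Nat.succ_eq_add_one]
  nlinarith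

theorem sum_theta {n i : ℕ} (hi : i ≤ n) :
    ∑ j ∈ Finset.range (i + 1), theta (n + 1) j = theta (n + 1) i ^ 2 := by
  induction i with
  | zero => simp [theta]
  | succ i ih =>
    rw [Finset.sum_range_succ, ih (by omega), theta_succ_sq_of_lt (by omega)]
    ring

/-- The offsets `b i` of the hard instance up to a common factor, for iteration count `n + 1`:
`level n 0 = 1` and `level n (i + 1) = level n i * (1 - 1 / (2 * θ_i))`.
Only the values at `i ≤ n + 1` matter. -/
noncomputable def level (n : ℕ) : ℕ → ℝ
  | 0 => 1
  | i + 1 => level n i * (1 - 1 / (2 * theta (n + 1) i))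

theorem level_pos (n i : ℕ) : 0 < level n i := by
  induction i with
  | zero => simp [level]
  | succ i ih =>
    have h := one_le_theta (n + 1) i
    have : 1 / (2 * theta (n + 1) i) < 1 := by
      rw [div_lt_one (by linarith)]
      linarith
    exact mul_pos ih (by linarith)

theorem level_succ (n i : ℕ) :
    level n (i + 1) + level n i / (2 * theta (n + 1) i) = level n i := by
  rw [level]
  ring

theorem level_antitone (n : ℕ) : Antitone (level n) := by
  refine antitone_nat_of_succ_le fun i => ?_
  have h := level_succ n i
  have h1 := one_le_theta (n + 1) i
  have h2 := level_pos n i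
  have : 0 < level n i / (2 * theta (n + 1) i) := by positivity
  linarith

theorem sum_theta_mul_level {n i : ℕ} (hi : i ≤ n) :
    ∑ j ∈ Finset.range (i + 1), 2 * theta (n + 1) j * level n j
      = 4 * theta (n + 1) i ^ 2 * level n (i + 1) := by
  have key : ∀ j, 4 * theta (n + 1) j ^ 2 * level n (j + 1)
      = (4 * theta (n + 1) j ^ 2 - 2 * theta (n + 1) j) * level n j := by
    intro j
    have h1 := one_le_theta (n + 1) j
    rw [level]
    field_simp
    ring
  induction i with
  | zero => rw [key]; norm_num [theta, level]
  | succ i ih =>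
    rw [Finset.sum_range_succ, ih (by omega), key (i + 1), theta_succ_sq_of_lt (by omega)]
    ring

/-- Coefficients of the hard instance. The condition `b j + c i ^ 2 ≤ b i` forces the gradient to
reveal one coordinate at a time, `∑ (b i / c i) ^ 2 = S` fixes the distance scale, and
`∑ b i / c i ^ 2 = θ_N²` places `(b i / (θ_N² * c i))_i` in the scaled simplex. The recursion
`b (i + 1) = b i - c i ^ 2` with `b i = 2 * θ_i * c i ^ 2` for `i < N` and `b N = θ_N * c N ^ 2`
solves the stationarity equations for maximizing `b N - c N ^ 2 / 2` at given `S`. -/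
theorem exists_chain_coefficients (hN : 0 < N) {S : ℝ} (hS : 0 < S) :
    ∃ b c : ℕ → ℝ, (∀ i, 0 < b i) ∧ (∀ i, 0 < c i) ∧
      (∀ i j, i < j → j ≤ N → b j + c i ^ 2 ≤ b i) ∧
      ∑ i ∈ Finset.range (N + 1), (b i / c i) ^ 2 = S ∧
      ∑ i ∈ Finset.range (N + 1), b i / c i ^ 2 = theta N N ^ 2 ∧
      b N - 1 / 2 * c N ^ 2 = S / (2 * theta N N ^ 2) := by
  obtain ⟨n, rfl⟩ := Nat.exists_eq_succ_of_ne_zero hN.ne'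
  simp only [Nat.succ_eq_add_one]
  set θ := theta (n + 1) with hθ
  have h1 : ∀ i, 1 ≤ θ i := one_le_theta (n + 1)
  have hT := one_lt_theta_last hN
  set T := θ (n + 1) with hTdef
  have hTT : 1 < T := hT
  have hlast : T ^ 2 = T + 2 * θ n ^ 2 := theta_last_sq
  have hl := level_pos n
  have hl' := hl (n + 1)
  -- The factor that normalizes `∑ (b i / c i) ^ 2` to `S`.
  set s : ℝ := S / (T * (2 * T - 1) * level n (n + 1)) with hs
  have hspos : 0 < s := by
    have : 0 < 2 * T - 1 := by linarith
    positivity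
  set τ : ℕ → ℝ := fun i => if i = n + 1 then T else 2 * θ i with hτ
  have hτlast : τ (n + 1) = T := if_pos rfl
  have hτlt : ∀ i, i ≤ n → τ i = 2 * θ i := fun i hi => if_neg (by omega)
  have hτpos : ∀ i, 0 < τ i := by
    intro i
    have := h1 i
    simp only [hτ]
    split_ifs <;> linarith
  have hb : ∀ i, 0 < s * level n i := fun i => mul_pos hspos (hl i)
  have hc2 : ∀ i, √(s * level n i / τ i) ^ 2 = s * level n i / τ i := fun i =>
    Real.sq_sqrt (div_pos (hb i) (hτpos i)).le
  refine ⟨fun i => s * level n i, fun i => √(s * level n i / τ i), hb,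
    fun i => Real.sqrt_pos.2 (div_pos (hb i) (hτpos i)), ?_, ?_, ?_, ?_⟩
  · intro i j hij hj
    rw [hc2, hτlt i (by omega)]
    have hanti := level_antitone n (show i + 1 ≤ j by omega)
    have := level_succ n i
    have e : s * level n i / (2 * θ i) = s * (level n i / (2 * θ i)) := by ring
    rw [e, ← mul_add]
    exact mul_le_mul_of_nonneg_left (by linarith) hspos.le
  · have e : ∀ i, (s * level n i / √(s * level n i / τ i)) ^ 2 = s * (τ i * level n i) := by
      intro i
      have := (hτpos i).ne'
      have := (hb i).ne'
      have := (hl i).ne'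
      rw [div_pow, hc2]
      field_simp
    simp only [e]
    rw [← Finset.mul_sum, Finset.sum_range_succ, hτlast, Finset.sum_congr rfl
      (g := fun i => 2 * θ i * level n i)
      (fun i hi => by rw [hτlt i (by simpa [Nat.lt_succ_iff] using hi)]),
      sum_theta_mul_level le_rfl]
    rw [show 4 * theta (n + 1) n ^ 2 * level n (n + 1) + T * level n (n + 1)
      = T * (2 * T - 1) * level n (n + 1) by linear_combination (-2 * level n (n + 1)) * hlast]
    have : T * 2 - 1 ≠ 0 := by linarith
    rw [hs]
    field_simp
  · have e : ∀ i, s * level n i / √(s * level n i / τ i) ^ 2 = τ i := by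
      intro i
      have := (hτpos i).ne'
      have := (hb i).ne'
      have := (hl i).ne'
      rw [hc2]
      field_simp
    simp only [e]
    rw [Finset.sum_range_succ, hτlast, Finset.sum_congr rfl
      (g := fun i => 2 * θ i)
      (fun i hi => by rw [hτlt i (by simpa [Nat.lt_succ_iff] using hi)]), ← Finset.mul_sum,
      sum_theta le_rfl]
    linarith
  · rw [hc2, hτlast, hs]
    have : T * 2 - 1 ≠ 0 := by linarith
    field_simp

end Theta

/-! ### The zero-chain property -/

section ZeroChain

variable {d N : ℕ}

/-- The vectors of `ℝ^d` all of whose coordinates of index at least `k` vanish. -/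
def leadingCoords (d k : ℕ) : Submodule ℝ (Euc d) where
  carrier := {y | ∀ j : Fin d, k ≤ j → y j = 0}
  add_mem' hx hy j hj := by simp [hx j hj, hy j hj]
  zero_mem' j _ := rfl
  smul_mem' a x hx j hj := by simp [hx j hj]

theorem leadingCoords_mono : Monotone (leadingCoords d) :=
  fun _ _ hkl _ hy j hj => hy j (hkl.trans hj)

/-- If, along an increasing chain of subspaces `V k`, a gradient evaluation moves up by one index
and a proximal evaluation not at all, then `N` evaluations of each kind end in `x₀ + V N`,
whatever their order. -/
theorem SpanCondition.sub_mem {x₀ xN : Euc d} {f : Euc d → ℝ} {h : Euc d → EReal}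
    (hspan : SpanCondition N x₀ f h xN) {V : ℕ → Submodule ℝ (Euc d)} (hV : Monotone V)
    (hgrad : ∀ k z, z - x₀ ∈ V k → gradient f z ∈ V (k + 1))
    (hprox : ∀ k γ z p, 0 < γ → IsProx γ h z p → z - x₀ ∈ V k → z - p ∈ V k) :
    xN - x₀ ∈ V N := by
  obtain ⟨δ, z, v, hδ, -, hcount, hv0, hv1, hz, hxN⟩ := hspan
  -- The index reached after step `i` is the number of gradient evaluations made so far.
  have hv : ∀ i, v i ∈ V (Finset.univ.filter fun j => j ≤ i ∧ δ j = 0).card := by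
    intro i
    induction i using WellFoundedLT.induction with
    | ind i ih =>
      have hzi : z i - x₀ ∈ V (Finset.univ.filter fun j => j < i ∧ δ j = 0).card := by
        refine Submodule.span_le.2 ?_ (hz i)
        rintro _ ⟨j, hj : j < i, rfl⟩
        refine hV (Finset.card_le_card fun l => ?_) (ih j hj)
        simp only [Finset.mem_filter, Finset.mem_univ, true_and]
        exact fun hl => ⟨hl.1.trans_lt hj, hl.2⟩
      rcases hδ i with h0 | h1
      · rw [hv0 i h0]
        refine hV ?_ (hgrad _ _ hzi)
        rw [← Finset.card_insert_of_notMem (a := i) (by simp)]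
        refine Finset.card_le_card fun l => ?_
        simp only [Finset.mem_insert, Finset.mem_filter, Finset.mem_univ, true_and]
        rintro (rfl | hl)
        · exact ⟨le_rfl, h0⟩
        · exact ⟨hl.1.le, hl.2⟩
      · obtain ⟨γ, hγ, p, hp, hvp⟩ := hv1 i h1
        rw [hvp]
        refine hV (Finset.card_le_card fun l => ?_) (hprox _ γ _ p hγ hp hzi)
        simp only [Finset.mem_filter, Finset.mem_univ, true_and]
        exact fun hl => ⟨hl.1.le, hl.2⟩
  have hN : (Finset.univ.filter fun j => δ j = 0).card = N := by
    have : ∑ i, (1 - δ i) = ((Finset.univ.filter fun j => δ j = 0).card : ℤ) := by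
      rw [Finset.card_filter]
      push_cast
      refine Finset.sum_congr rfl fun i _ => ?_
      rcases hδ i with h | h <;> simp [h]
    exact_mod_cast this.symm.trans hcount
  refine Submodule.span_le.2 ?_ hxN
  rintro _ ⟨i, rfl⟩
  refine hV ?_ (hv i)
  refine le_of_le_of_eq (Finset.card_le_card fun l => ?_) hN
  simp only [Finset.mem_filter, Finset.mem_univ, true_and]
  exact fun hl => hl.2

/-- The simplex with vertices `c i • e_i`, `i ≤ N`, on the first `N + 1` coordinate axes of `ℝ^d`.
It is described by equations: the coordinates of index above `N` vanish, so the values `c i` with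
`i > N` do not matter. -/
def scaledSimplex (d N : ℕ) (c : ℕ → ℝ) : Set (Euc d) :=
  {p | (∀ i, 0 ≤ p i) ∧ (∀ i : Fin d, N < i → p i = 0) ∧ ∑ i : Fin d, p i / c i = 1}

theorem isClosed_scaledSimplex (c : ℕ → ℝ) : IsClosed (scaledSimplex d N c) := by
  have h1 : IsClosed {p : Euc d | ∀ i, 0 ≤ p i} := by
    simp only [Set.ofPred_forall]
    exact isClosed_iInter fun i => isClosed_le continuous_const (by fun_prop)
  have h2 : IsClosed {p : Euc d | ∀ i : Fin d, N < i → p i = 0} := by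
    simp only [Set.ofPred_forall]
    exact isClosed_iInter fun i => isClosed_iInter fun _ => isClosed_eq (by fun_prop) (by fun_prop)
  have h3 : IsClosed {p : Euc d | ∑ i : Fin d, p i / c i = 1} :=
    isClosed_eq (by fun_prop) (by fun_prop)
  exact h1.inter (h2.inter h3)

theorem convex_scaledSimplex (c : ℕ → ℝ) : Convex ℝ (scaledSimplex d N c) := by
  rintro x ⟨hx1, hx2, hx3⟩ y ⟨hy1, hy2, hy3⟩ s t hs ht hst
  refine ⟨fun i => ?_, fun i hi => ?_, ?_⟩
  · have := hx1 i
    have := hy1 i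
    simp only [PiLp.add_apply, PiLp.smul_apply, smul_eq_mul]
    positivity
  · simp [hx2 i hi, hy2 i hi]
  · simp only [PiLp.add_apply, PiLp.smul_apply, smul_eq_mul, add_div, mul_div_assoc,
      Finset.sum_add_distrib, ← Finset.mul_sum, hx3, hy3, mul_one, hst]

/-- If the coordinates of `u` from index `k` on are the unperturbed values `b j / c j`, then the
projection of `u` onto the scaled simplex uses only the vertices of index at most `k`: mass sitting
on a vertex `j > k` could be moved to the vertex `k`, against the variational inequality. -/
theorem projection_mem_leadingCoords {b c : ℕ → ℝ} (hc : ∀ i, 0 < c i)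
    (hbc : ∀ i j, i < j → j ≤ N → b j + c i ^ 2 ≤ b i) {P : Euc d → Euc d}
    (hP : ∀ u, P u ∈ scaledSimplex d N c ∧
      ∀ w ∈ scaledSimplex d N c, inner ℝ (u - P u) (w - P u) ≤ 0)
    {k : ℕ} {u : Euc d} (hu : ∀ j : Fin d, k ≤ j → (j : ℕ) ≤ N → u j = b j / c j) :
    P u ∈ leadingCoords d (k + 1) := by
  obtain ⟨⟨hp0, hpN, hp1⟩, hvi⟩ := hP u
  set p := P u with hp
  rintro j hj
  by_cases hjN : N < j
  · exact hpN j hjN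
  push Not at hjN
  let i : Fin d := ⟨k, by omega⟩
  have hij : (i : ℕ) < j := hj
  have hne : i ≠ j := fun h => by simp [h] at hij
  have hci := hc i
  have hcj := hc j
  have hpi : p i ≤ c i := by
    rw [← div_le_one hci, ← hp1]
    exact Finset.single_le_sum (f := fun i : Fin d => p i / c i)
      (fun l _ => div_nonneg (hp0 l) (hc l).le) (Finset.mem_univ i)
  -- All the mass at the vertex `j` is moved to the vertex `i`.
  have hw : p + p j • ((c i / c j) • EuclideanSpace.single i (1 : ℝ)
      - EuclideanSpace.single j (1 : ℝ)) ∈ scaledSimplex d N c := by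
    refine ⟨fun l => ?_, fun l hl => ?_, ?_⟩
    · have := hp0 l
      have := hp0 j
      rcases eq_or_ne l j with rfl | hlj
      · simp [hne.symm]
      · rcases eq_or_ne l i with rfl | hli
        · simp [hlj]
          positivity
        · simpa [hlj, hli]
    · have hlj : l ≠ j := fun h => by subst h; omega
      have hli : l ≠ i := fun h => by subst h; omega
      simp [hlj, hli, hpN l hl]
    · simp only [PiLp.add_apply, PiLp.smul_apply, PiLp.sub_apply, smul_eq_mul, add_div,
        Finset.sum_add_distrib, hp1, mul_sub, sub_div, Finset.sum_sub_distrib, PiLp.single_apply]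
      simp [ite_div]
      field_simp
      simp
  have h := hvi _ hw
  rw [add_sub_cancel_left, inner_smul_right, inner_sub_right, inner_smul_right,
    EuclideanSpace.inner_single_right, EuclideanSpace.inner_single_right] at h
  simp only [PiLp.sub_apply, conj_trivial, one_mul] at h
  rw [hu i le_rfl (by omega), hu j (by omega) hjN] at h
  have e : p j * (c i / c j * (b i / c i - p i) - (b j / c j - p j))
      = p j / c j * ((b i - b j - c i ^ 2) + c i * (c i - p i)) + p j ^ 2 := by
    field_simp
    ring
  rw [e] at h
  have h1 := hbc i j hij hjN
  have h2 : 0 ≤ p j / c j * ((b i - b j - c i ^ 2) + c i * (c i - p i)) :=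
    mul_nonneg (div_nonneg (hp0 j) hcj.le)
      (add_nonneg (by linarith) (mul_nonneg hci.le (by linarith)))
  exact pow_eq_zero_iff two_ne_zero |>.1 (le_antisymm (by linarith) (sq_nonneg _))

/-- The proximal map of an orthant containing `x₀` reveals no coordinate: it acts coordinatewise and
fixes the coordinates that agree with those of `x₀`. -/
theorem sub_prox_mem_leadingCoords {a x₀ : Euc d} (ha : ∀ i, a i ≤ x₀ i) {γ : ℝ} (hγ : 0 < γ)
    {k : ℕ} {z p : Euc d} (hp : IsProx γ (indicatorFn {x | ∀ i, a i ≤ x i}) z p)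
    (hz : z - x₀ ∈ leadingCoords d k) : z - p ∈ leadingCoords d k := by
  have hpC : ∀ i, a i ≤ p i := by
    by_contra hcon
    have h := hp x₀
    simp only [indicatorFn, Set.mem_ofPred_eq, if_neg hcon, if_pos ha, zero_add,
      EReal.top_add_coe, top_le_iff] at h
    exact EReal.coe_ne_top _ h
  -- Resetting the late coordinates of `p` to those of `x₀` stays in the orthant and gets no farther
  -- from `z`, strictly closer unless nothing changed.
  let q : Euc d := WithLp.toLp 2 fun j => if k ≤ (j : ℕ) then x₀ j else p j
  have hqC : ∀ i, a i ≤ q i := by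
    intro i
    by_cases hi : k ≤ (i : ℕ)
    · simpa [q, hi] using ha i
    · simpa [q, hi] using hpC i
  have h := hp q
  simp only [indicatorFn, Set.mem_ofPred_eq, if_pos hpC, if_pos hqC, zero_add,
    EReal.coe_le_coe_iff] at h
  have h' : ‖p - z‖ ^ 2 ≤ ‖q - z‖ ^ 2 := le_of_mul_le_mul_left h (by positivity)
  rw [EuclideanSpace.real_norm_sq_eq, EuclideanSpace.real_norm_sq_eq] at h'
  have hqz : ∀ j : Fin d, k ≤ (j : ℕ) → (q - z) j = 0 := by
    intro j hj
    have := hz j hj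
    simp only [PiLp.sub_apply] at this ⊢
    simp only [q, hj, if_true]
    linarith
  have hle : ∀ j ∈ Finset.univ, (q - z) j ^ 2 ≤ (p - z) j ^ 2 := by
    intro j _
    by_cases hj : k ≤ (j : ℕ)
    · rw [hqz j hj, zero_pow two_ne_zero]
      exact sq_nonneg _
    · simp [q, hj]
  have heq := (Finset.sum_eq_sum_iff_of_le hle).1 (le_antisymm (Finset.sum_le_sum hle) h')
  intro j hj
  have := heq j (Finset.mem_univ j)
  rw [hqz j hj] at this
  have h0 : (p - z) j = 0 := by
    simpa using this.symm
  simp only [PiLp.sub_apply] at h0 ⊢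
  linarith

theorem closedConvexProper_indicatorFn {C : Set (Euc d)} (hne : C.Nonempty) (hcl : IsClosed C)
    (hconv : Convex ℝ C) : ClosedConvexProper (indicatorFn C) := by
  refine ⟨fun x => ?_, ?_, ?_, ?_⟩
  · simp only [indicatorFn]
    split_ifs <;> simp
  · obtain ⟨x, hx⟩ := hne
    exact ⟨x, by simp [indicatorFn, hx]⟩
  · intro x y hy
    by_cases hx : x ∈ C
    · refine .of_forall fun w => lt_of_lt_of_le hy ?_
      simp only [indicatorFn, if_pos hx]
      split_ifs <;> simp
    · filter_upwards [hcl.isOpen_compl.mem_nhds hx] with w hw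
      have hw' : w ∉ C := hw
      simpa [indicatorFn, hx, hw'] using hy
  · intro x y t ht0 ht1
    have ht1' : 0 < 1 - t := by linarith
    have hnn : ∀ s : ℝ, 0 < s → ∀ w, 0 ≤ (s : EReal) * indicatorFn C w := by
      intro s hs w
      refine mul_nonneg (EReal.coe_nonneg.2 hs.le) ?_
      simp only [indicatorFn]
      split_ifs <;> simp
    by_cases hx : x ∈ C
    · by_cases hy : y ∈ C
      · have : t • x + (1 - t) • y ∈ C := hconv hx hy ht0.le ht1'.le (by ring)
        simp [indicatorFn, hx, hy, this]
      · have h : ((1 - t : ℝ) : EReal) * indicatorFn C y = ⊤ := by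
          simp only [indicatorFn, if_neg hy]
          exact EReal.coe_mul_top_of_pos ht1'
        rw [h, EReal.add_top_of_ne_bot (ne_of_gt (lt_of_lt_of_le EReal.bot_lt_zero (hnn t ht0 x)))]
        exact le_top
    · have h : (t : EReal) * indicatorFn C x = ⊤ := by
        simp only [indicatorFn, if_neg hx]
        exact EReal.coe_mul_top_of_pos ht0
      rw [h, EReal.top_add_of_ne_bot
        (ne_of_gt (lt_of_lt_of_le EReal.bot_lt_zero (hnn (1 - t) ht1' y)))]
      exact le_top

theorem sum_ite_le_eq_sum_range (hN : N < d) (F : ℕ → ℝ) :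
    ∑ i : Fin d, (if (i : ℕ) ≤ N then F i else 0) = ∑ i ∈ Finset.range (N + 1), F i := by
  rw [Fin.sum_univ_eq_sum_range (fun i => if i ≤ N then F i else 0) d, ← Finset.sum_filter]
  refine Finset.sum_congr ?_ fun _ _ => rfl
  ext i
  simp only [Finset.mem_filter, Finset.mem_range]
  omega

end ZeroChain

/-! ### The hard instance -/

/-- A single problem, independent of the method, on which every output reachable under the span
condition has the required objective gap. With `u₀ i = b i / c i` for `i ≤ N` and `p = u₀ / θ_N²`,
the function is `f x = L * max_{w ∈ K} (⟪x - x₀ + u₀, w⟫ - ‖w‖² / 2)` for the scaled simplex `K`,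
the minimizer is `xs = x₀ + p - u₀`, and `C` is the orthant `{x | xs ≤ x}`. -/
theorem exists_hard_instance {L R : ℝ} {N d : ℕ} (hL : 0 < L) (hR : 0 < R) (hN : 0 < N)
    (hd : N + 1 ≤ d) (x₀ : Euc d) :
    ∃ (f : Euc d → ℝ) (C : Set (Euc d)) (xs : Euc d),
      LSmoothConvex L f ∧ C.Nonempty ∧ IsClosed C ∧ Convex ℝ C ∧
      IsMinimizer f (indicatorFn C) xs ∧ ‖x₀ - xs‖ = R ∧
      ∀ x, SpanCondition N x₀ f (indicatorFn C) x →
        ((L * ‖x₀ - xs‖ ^ 2 / (2 * (theta N N ^ 2 - 1)) : ℝ) : EReal)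
          ≤ (f x : EReal) + indicatorFn C x - (f xs : EReal) - indicatorFn C xs := by
  have hT := one_lt_theta_last hN
  set T := theta N N with hTdef
  have hT2 : 0 < T ^ 2 - 1 := by nlinarith
  have hT0 : 0 < T := by linarith
  obtain ⟨b, c, hb, hc, hbc, hsq, hsum, hgap⟩ :=
    exists_chain_coefficients hN (S := (R * T ^ 2 / (T ^ 2 - 1)) ^ 2) (by positivity)
  rw [← hTdef] at hsum hgap
  let u₀ : Euc d := WithLp.toLp 2 fun i => if (i : ℕ) ≤ N then b i / c i else 0
  have hu₀ : ∀ i : Fin d, u₀ i = if (i : ℕ) ≤ N then b i / c i else 0 := fun _ => rfl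
  have hu₀nn : ∀ i, 0 ≤ u₀ i := by
    intro i
    have := hb i
    have := hc i
    rw [hu₀]
    split_ifs <;> positivity
  have hu₀norm : ‖u₀‖ = R * T ^ 2 / (T ^ 2 - 1) := by
    rw [← sq_eq_sq₀ (norm_nonneg _) (by positivity), EuclideanSpace.real_norm_sq_eq, ← hsq,
      ← sum_ite_le_eq_sum_range (Nat.lt_of_succ_le hd)]
    refine Finset.sum_congr rfl fun i _ => ?_
    rw [hu₀]
    split_ifs <;> simp
  set p : Euc d := (1 / T ^ 2) • u₀ with hp
  have hpi : ∀ i, p i = 1 / T ^ 2 * u₀ i := fun i => rfl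
  have hpnn : ∀ i, 0 ≤ p i := fun i => mul_nonneg (by positivity) (hu₀nn i)
  have hpK : p ∈ scaledSimplex d N c := by
    refine ⟨hpnn, fun i hi => ?_, ?_⟩
    · rw [hpi, hu₀, if_neg (by omega), mul_zero]
    · have e : ∀ i : Fin d, p i / c i
          = 1 / T ^ 2 * (if (i : ℕ) ≤ N then b i / c i ^ 2 else 0) := by
        intro i
        have := (hc i).ne'
        rw [hpi, hu₀]
        split_ifs
        · field_simp
        · simp
      simp only [e]
      rw [← Finset.mul_sum, sum_ite_le_eq_sum_range (Nat.lt_of_succ_le hd)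
        fun i => b i / c i ^ 2, hsum]
      field_simp
  obtain ⟨P, hP⟩ := exists_metric_projection ⟨p, hpK⟩ (isClosed_scaledSimplex c)
    (convex_scaledSimplex c)
  have hPle : ∀ u, ∀ {w}, w ∈ scaledSimplex d N c →
      inner ℝ u w - 1 / 2 * ‖w‖ ^ 2 + 1 / 2 * ‖P u - w‖ ^ 2
        ≤ inner ℝ u (P u) - 1 / 2 * ‖P u‖ ^ 2 := inner_sub_half_norm_sq_le hP
  set f : Euc d → ℝ := fun x => L * (inner ℝ (x - x₀ + u₀) (P (x - x₀ + u₀))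
    - 1 / 2 * ‖P (x - x₀ + u₀)‖ ^ 2) with hf
  set xs : Euc d := x₀ + p - u₀ with hxs
  set C : Set (Euc d) := {x | ∀ i, xs i ≤ x i} with hC
  -- On `C` the point `x - x₀ + u₀` dominates `p ≥ 0` coordinatewise; test the maximum at `p`.
  have hfC : ∀ x ∈ C, L / 2 * ‖p‖ ^ 2 ≤ f x := by
    intro x hx
    have h := hPle (x - x₀ + u₀) hpK
    have h1 : ‖p‖ ^ 2 ≤ inner ℝ (x - x₀ + u₀) p := by
      rw [EuclideanSpace.real_norm_sq_eq, PiLp.inner_apply]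
      refine Finset.sum_le_sum fun i _ => ?_
      have h2 : xs i ≤ x i := hx i
      have h3 : xs i = x₀ i + p i - u₀ i := rfl
      simp only [PiLp.add_apply, PiLp.sub_apply, RCLike.inner_apply, conj_trivial]
      nlinarith [hpnn i]
    have h4 : 0 ≤ 1 / 2 * ‖P (x - x₀ + u₀) - p‖ ^ 2 := by positivity
    rw [hf, show L / 2 * ‖p‖ ^ 2 = L * (1 / 2 * ‖p‖ ^ 2) by ring]
    exact mul_le_mul_of_nonneg_left (by linarith) hL.le
  -- At `xs` the shifted point is `p` itself, which already lies in `K` and is its own projection.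
  have hfxs : f xs = L / 2 * ‖p‖ ^ 2 := by
    have hPp : P p = p := by
      have h := (hP p).2 p hpK
      rw [real_inner_self_eq_norm_sq] at h
      exact (sub_eq_zero.1 (norm_eq_zero.1 (pow_eq_zero_iff two_ne_zero |>.1
        (le_antisymm h (sq_nonneg _))))).symm
    have e : xs - x₀ + u₀ = p := by rw [hxs]; abel
    rw [hf]
    simp only [e, hPp, real_inner_self_eq_norm_sq]
    ring
  have hlower : ∀ x y, f x + inner ℝ (L • P (x - x₀ + u₀)) (y - x)
      + 1 / (2 * L) * ‖L • P (x - x₀ + u₀) - L • P (y - x₀ + u₀)‖ ^ 2 ≤ f y := by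
    intro x y
    have h := mul_le_mul_of_nonneg_left (hPle (y - x₀ + u₀) (hP (x - x₀ + u₀)).1) hL.le
    have e : inner ℝ (y - x₀ + u₀) (P (x - x₀ + u₀)) = inner ℝ (x - x₀ + u₀) (P (x - x₀ + u₀))
        + inner ℝ (P (x - x₀ + u₀)) (y - x) := by
      rw [real_inner_comm (y - x) (P (x - x₀ + u₀)), ← inner_add_left]
      congr 1
      abel
    rw [e, norm_sub_rev] at h
    rw [← smul_sub, norm_smul, inner_smul_left, Real.norm_eq_abs, mul_pow, sq_abs, conj_trivial,
      show 1 / (2 * L) * (L ^ 2 * ‖P (x - x₀ + u₀) - P (y - x₀ + u₀)‖ ^ 2)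
        = L * (1 / 2 * ‖P (x - x₀ + u₀) - P (y - x₀ + u₀)‖ ^ 2) by field_simp]
    simp only [hf]
    linarith
  have hgrad : ∀ x, HasGradientAt f (L • P (x - x₀ + u₀)) x :=
    hasGradientAt_of_quadratic_lower_bound hL hlower
  have hsmooth : LSmoothConvex L f := by
    refine ⟨fun x => (hgrad x).differentiableAt, fun x y => ?_⟩
    rw [(hgrad x).gradient, (hgrad y).gradient]
    exact hlower x y
  have hxsC : xs ∈ C := fun i => le_rfl
  have hCcl : IsClosed C := by
    simp only [hC, Set.ofPred_forall]
    exact isClosed_iInter fun i => isClosed_le continuous_const (by fun_prop)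
  have hCconv : Convex ℝ C := by
    intro x hx y hy s t hs ht hst i
    calc xs i = s * xs i + t * xs i := by rw [← add_mul, hst, one_mul]
      _ ≤ s * x i + t * y i :=
        add_le_add (mul_le_mul_of_nonneg_left (hx i) hs) (mul_le_mul_of_nonneg_left (hy i) ht)
  have hmin : IsMinimizer f (indicatorFn C) xs := by
    intro y
    by_cases hy : y ∈ C
    · simp only [indicatorFn, if_pos hxsC, if_pos hy, add_zero, EReal.coe_le_coe_iff, hfxs]
      exact hfC y hy
    · simp [indicatorFn, hy]
  have hdist : ‖x₀ - xs‖ = R := by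
    have e : x₀ - xs = (1 - 1 / T ^ 2) • u₀ := by
      rw [hxs, hp, sub_smul, one_smul]
      abel
    have h1 : 1 - 1 / T ^ 2 = (T ^ 2 - 1) / T ^ 2 := by field_simp
    rw [e, norm_smul, hu₀norm, h1, Real.norm_of_nonneg (by positivity)]
    field_simp
  refine ⟨f, C, xs, hsmooth, ⟨xs, hxsC⟩, hCcl, hCconv, hmin, hdist, fun x hspan => ?_⟩
  have hmem : x - x₀ ∈ leadingCoords d N := by
    refine hspan.sub_mem leadingCoords_mono (fun k z hz => ?_) (fun k γ z q hγ hq hz => ?_)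
    · rw [(hgrad z).gradient]
      refine Submodule.smul_mem _ _ (projection_mem_leadingCoords hc hbc hP ?_)
      intro j hj hjN
      rw [PiLp.add_apply, hz j hj, zero_add, hu₀, if_pos hjN]
    · refine sub_prox_mem_leadingCoords (fun i => ?_) hγ hq hz
      have h3 : xs i = x₀ i + p i - u₀ i := rfl
      have h4 : p i ≤ u₀ i := by
        rw [hpi]
        exact mul_le_of_le_one_left (hu₀nn i) ((div_le_one (by positivity)).2 (by linarith))
      linarith
  -- The coordinate `N` of `x - x₀` vanishes, so testing the maximum at the vertex `c N • e_N`
  -- gives a bound that does not depend on `x`.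
  have hfx : L * (b N - 1 / 2 * c N ^ 2) ≤ f x := by
    let n : Fin d := ⟨N, by omega⟩
    have hw : c N • EuclideanSpace.single n (1 : ℝ) ∈ scaledSimplex d N c := by
      refine ⟨fun i => ?_, fun i hi => ?_, ?_⟩
      · have := hc N
        rcases eq_or_ne i n with rfl | hi
        · simp [this.le]
        · simp [hi]
      · have : i ≠ n := fun h => by subst h; exact lt_irrefl _ hi
        simp [this]
      · simp only [PiLp.smul_apply, PiLp.single_apply, smul_eq_mul]
        simp [ite_div, n, (hc N).ne']
    have h := hPle (x - x₀ + u₀) hw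
    have hn := hmem n le_rfl
    have h4 : 0 ≤ 1 / 2 * ‖P (x - x₀ + u₀) - c N • EuclideanSpace.single n (1 : ℝ)‖ ^ 2 := by
      positivity
    rw [inner_smul_right, EuclideanSpace.inner_single_right, PiLp.add_apply, hn, hu₀,
      if_pos (show (n : ℕ) ≤ N from le_rfl), norm_smul, PiLp.norm_single, Real.norm_eq_abs, mul_pow,
      sq_abs] at h
    simp only [conj_trivial, n, norm_one, one_pow, mul_one, one_mul, zero_add,
      mul_div_cancel₀ _ (hc N).ne'] at h h4
    exact mul_le_mul_of_nonneg_left (by linarith) hL.le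
  by_cases hxC : x ∈ C
  -- Output in `C`: both values of the indicator vanish, and the gap is a real computation.
  · simp only [indicatorFn, if_pos hxC, if_pos hxsC, add_zero, sub_zero, hfxs]
    rw [← EReal.coe_sub, EReal.coe_le_coe_iff, hdist]
    refine le_trans (le_of_eq ?_) (sub_le_sub_right hfx _)
    rw [hgap, hp, norm_smul, hu₀norm, Real.norm_of_nonneg (by positivity)]
    field_simp
  · simp only [indicatorFn, if_neg hxC, if_pos hxsC, sub_zero]
    rw [EReal.coe_add_top, EReal.top_sub_coe]
    exact le_top

end CompositeOpt

theorem theorem2 (L R : ℝ) (N d : ℕ) (hL : 0 < L) (hR : 0 < R) (hN : 0 < N) (hd : N + 1 ≤ d)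
    (x₀ : CompositeOpt.Euc d)
    (M : (CompositeOpt.Euc d → ℝ) → (CompositeOpt.Euc d → EReal) → CompositeOpt.Euc d)
    (hM : CompositeOpt.MethodSatisfiesSpan L N x₀ M) :
    ∃ (f : CompositeOpt.Euc d → ℝ) (h : CompositeOpt.Euc d → EReal) (xstar : CompositeOpt.Euc d),
      CompositeOpt.LSmoothConvex L f ∧
      (∃ C : Set (CompositeOpt.Euc d),
        C.Nonempty ∧ IsClosed C ∧ Convex ℝ C ∧ h = CompositeOpt.indicatorFn C) ∧
      CompositeOpt.IsMinimizer f h xstar ∧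
      ‖x₀ - xstar‖ = R ∧
      ((L * ‖x₀ - xstar‖ ^ 2 / (2 * (CompositeOpt.theta N N ^ 2 - 1)) : ℝ) : EReal)
        ≤ (f (M f h) : EReal) + h (M f h) - (f xstar : EReal) - h xstar := by
  obtain ⟨f, C, xs, hf, hne, hcl, hconv, hmin, hdist, hgap⟩ :=
    CompositeOpt.exists_hard_instance hL hR hN hd x₀
  exact ⟨f, CompositeOpt.indicatorFn C, xs, hf, ⟨C, hne, hcl, hconv, rfl⟩, hmin, hdist,
    hgap _ (hM f _ hf (CompositeOpt.closedConvexProper_indicatorFn hne hcl hconv) ⟨xs, hmin⟩)⟩
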